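/- **Setting.** Let $\mathcal X$ be a measurable space. A *classification DGP* $\mathcal D$ on $\mathcal X$ consists of a law of $x\in\mathcal X$ and a measurable $\eta^*:\mathcal X\to[0,1]$; a draw $z=(x,y)\sim\mathcal D$ has $y\in\{-1,1\}$ with $\mathbb P(y=1\mid x)=\eta^*(x)$. Its Bayes classifier is $f^*(x)=1$ if $\eta^*(x)\ge\frac12$ and $f^*(x)=-1$ otherwise, and its margin function is $\omega^*(x)=2\,\mathbb P(y=f^*(x)\mid x)-1$. For a sample $S_n=((x_i,y_i))_{i\le n}$, a class $\mathcal F$ of classifiers $\mathcal X\to\{-1,1\}$ and a weight $\omega:\mathcal X\to[0,1]$, a *weighted ERM* is any minimizer over $f\in\mathcal F$ of $\frac1n\sum_{i=1}^n\omega(x_i)\mathbb 1\{f(x_i)\ne y_i\}$. **Theorem.** There are absolute constants $\kappa,K>0$, a finite set $\mathcal X$ (with the discrete $\sigma$-algebra), a class $\mathcal F$ of functions $\mathcal X\to\{-1,1\}$ of finite VC dimension and a class $\mathcal G$ of functions $\mathcal X\to[0,1]$ of finite pseudo-dimension such that for every $c\in(0,1)$ and $p\in(0,1]$ there is a family $\Theta$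 of classification DGPs on $\mathcal X$ for which the following holds. 1. Every $\mathcal D\in\Theta$ satisfies $f^*\in\mathcal F$, $\eta^*\in\mathcal G$, $\omega^*(x)\in\{0\}\cup(c,1]$ for all $x\in\mathcal X$, and $\mathbb P(\omega^*(x)>c)=p$. 2. (Lower bound.) Let $0<\varepsilon\le\kappa pc^2$ and let $n\le\kappa/\varepsilon$ (in particular $n=\lfloor\kappa/\varepsilon\rfloor\asymp1/\varepsilon$ is allowed). For every learning rule $\hat f$, that is, every map from samples $S_n\in(\mathcal X\times\{-1,1\})^n$ to classifiers $\mathcal X\to\{-1,1\}$ (not necessarily in $\mathcal F$), there is $\mathcal D\in\Theta$ such that, with $S_n$ i.i.d. from $\mathcal D$ and $\hat f=\hat f(S_n)$, $$c\;\mathbb E_{S_n}\mathbb E_{z\sim\mathcal D}\big[\mathbb 1\{\hat f(x)\ne y\}-\mathbb 1\{f^*(x)\ne y\},\ \omega^*(x)\ge c\big]\ \ge\ \varepsilon$$ and $$\mathbb E_{S_n}\mathbb E_{z\sim\mathcal D}\big[\mathbb 1\{\hat f(x)\ne y\}-\mathbb 1\{f^*(x)\ne y\}\,\big|\,\omega^*(x)\ge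 c\big]\ \ge\ \frac{\varepsilon}{c\,\mathbb P(\omega^*(x)>c)}.$$ 3. (The bound is attained by weighted ERM, hence minimax tight up to constants.) Let $\mathcal D\in\Theta$, $\varepsilon>0$, $\delta\in(0,1)$ and $n\ge K\log(2/\delta)/\varepsilon$, and let $\omega:\mathcal X\to[0,1]$ be a fixed weight function with $\mathbb E_x[(\omega(x)-\omega^*(x))^2]\le\varepsilon$ (for instance $\omega=\omega^*$). Then with probability at least $1-\delta$ over $S_n$ i.i.d. from $\mathcal D$, every weighted ERM $\hat f$ over $\mathcal F$ with weight $\omega$ satisfies $$\mathbb E_{z\sim\mathcal D}\big[\mathbb 1\{\hat f(x)\ne y\}-\mathbb 1\{f^*(x)\ne y\}\,\big|\,\omega^*(x)\ge c\big]\ \le\ \frac{\varepsilon}{c\,\mathbb P(\omega^*(x)>c)}.$$ -/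

import Mathlib

open MeasureTheory ProbabilityTheory

noncomputable section

/-- `H` shatters the finite set `s`: every labelling of `s` is realised by a member of `H`. -/
def Shatters {α : Type*} (H : Set (α → Bool)) (s : Finset α) : Prop :=
  ∀ t ⊆ s, ∃ h ∈ H, ∀ x ∈ s, (h x = true ↔ x ∈ t)

/-- `H` has finite VC dimension. -/
def FiniteVCDim {α : Type*} (H : Set (α → Bool)) : Prop :=
  ∃ d : ℕ, ∀ s : Finset α, Shatters H s → s.card ≤ d

/-- A real-valued class has finite pseudo-dimension: the class of the indicator functions
`(x, t) ↦ [t ≤ g x]` of the subgraphs of its members has finite VC dimension. -/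
def FinitePseudoDim {X : Type*} (G : Set (X → ℝ)) : Prop :=
  FiniteVCDim {h : X × ℝ → Bool | ∃ g ∈ G, h = fun q => decide (q.2 ≤ g q.1)}

/-- A data generating process for binary classification: a law `μ` of the feature `x` and the
conditional probability `η x = P(y = 1 | x)`. The label `1` is encoded by `true` and the
label `-1` by `false`. -/
structure DGP (X : Type*) [MeasurableSpace X] where
  μ : Measure X
  prob : IsProbabilityMeasure μ
  η : X → ℝ
  measurable_η : Measurable η
  η_mem : ∀ x, η x ∈ Set.Icc (0 : ℝ) 1

namespace DGP

variable {X : Type*} [MeasurableSpace X]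

/-- `P(y = b | x)`. -/
def labelProb (D : DGP X) (x : X) (b : Bool) : ℝ := if b then D.η x else 1 - D.η x

/-- The joint law of `z = (x, y)`. -/
def joint (D : DGP X) : Measure (X × Bool) :=
  (D.μ.withDensity fun x => ENNReal.ofReal (D.labelProb x true)).map (fun x => (x, true)) +
    (D.μ.withDensity fun x => ENNReal.ofReal (D.labelProb x false)).map (fun x => (x, false))

instance (D : DGP X) : IsProbabilityMeasure D.joint := by
  have := D.prob
  have hη := D.measurable_η
  have ht : Measurable fun x : X => (x, true) := by fun_prop
  have hf : Measurable fun x : X => (x, false) := by fun_prop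
  constructor
  rw [joint, Measure.add_apply, Measure.map_apply ht .univ, Measure.map_apply hf .univ,
    Set.preimage_univ, Set.preimage_univ, withDensity_apply _ .univ, withDensity_apply _ .univ,
    Measure.restrict_univ, ← lintegral_add_left (by simp only [labelProb, ↓reduceIte]; fun_prop)]
  have h1 : ∀ x, ENNReal.ofReal (D.labelProb x true) + ENNReal.ofReal (D.labelProb x false) = 1 := by
    intro x
    have := D.η_mem x
    rw [← ENNReal.ofReal_add] <;> simp [labelProb, this.1, this.2]
  simp [h1]

/-- The law of `n` independent draws from the joint law. -/
def sample (D : DGP X) (n : ℕ) : Measure (Fin n → X × Bool) :=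
  Measure.pi fun _ => D.joint

/-- The Bayes classifier `f*`. -/
def bayes (D : DGP X) (x : X) : Bool := decide (1 / 2 ≤ D.η x)

/-- The margin function `ω*(x) = 2 P(y = f*(x) | x) - 1`. -/
def margin (D : DGP X) (x : X) : ℝ := 2 * D.labelProb x (D.bayes x) - 1

/-- The excess 0-1 loss of the classifier `f` at `z = (x, y)`. -/
def excessLoss (D : DGP X) (f : X → Bool) (z : X × Bool) : ℝ :=
  (if f z.1 ≠ z.2 then 1 else 0) - (if D.bayes z.1 ≠ z.2 then 1 else 0)

/-- `E[1{f(x) ≠ y} - 1{f*(x) ≠ y}, ω*(x) ≥ c]`. -/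
def excessOn (D : DGP X) (c : ℝ) (f : X → Bool) : ℝ :=
  ∫ z in {z | c ≤ D.margin z.1}, D.excessLoss f z ∂D.joint

/-- `E[1{f(x) ≠ y} - 1{f*(x) ≠ y} | ω*(x) ≥ c]`. -/
def condExcess (D : DGP X) (c : ℝ) (f : X → Bool) : ℝ :=
  ∫ z, D.excessLoss f z ∂(D.joint[|{z | c ≤ D.margin z.1}])

end DGP

/-- The empirical 0-1 risk on the sample `S`, weighted by `ω`. -/
def weightedRisk {X : Type*} {n : ℕ} (ω : X → ℝ) (S : Fin n → X × Bool) (f : X → Bool) : ℝ :=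
  (1 / (n : ℝ)) * ∑ i, ω (S i).1 * (if f (S i).1 ≠ (S i).2 then 1 else 0)

/-- `f` is a weighted empirical risk minimiser over `F` with weight `ω`. -/
def IsWeightedERM {X : Type*} {n : ℕ} (F : Set (X → Bool)) (ω : X → ℝ) (S : Fin n → X × Bool)
    (f : X → Bool) : Prop :=
  f ∈ F ∧ ∀ g ∈ F, weightedRisk ω S f ≤ weightedRisk ω S g

end

/-! Three points suffice: `0` of mass `q` with unknown Bayes label `b`, `1` of mass `p - q` with
known label, both of margin `m` slightly above `c`, and pure noise at `2`. A wrong decision at `0`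
costs `q m`. Lower bound: the processes with `b = true` and `b = false` have one-draw affinity at
least `1 - q m²` (`IsThreePoint.le_affinity`), so Le Cam's method (`affinity_pow_le`) makes any rule
err at `0` with probability at least `1/8` under one of them while `n q m² ≤ 1/4`. Taking `q` of
order `ε / c²` yields excess `ε / c` for `n` up to order `1 / ε`. Upper bound: members of `F` can
err only at `0`. Either `q m ≤ ε / c` and the error is harmless, or `q m² > ε`; then `ω 0 > 0`, and
weighted ERM is a majority vote at `0`, controlled by Chernoff (`sample_real_minority_le`). -/

section FiniteClasses

theorem finiteVCDim_of_finite {α : Type*} [Finite α] (H : Set (α → Bool)) : FiniteVCDim H := by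
  have := Fintype.ofFinite α
  exact ⟨Fintype.card α, fun s _ => s.card_le_univ⟩

/-- On a finite space every class of real-valued functions has finite pseudo-dimension: a set
shattered by the subgraphs contains at most one point above each `x`. -/
theorem finitePseudoDim_of_finite {X : Type*} [Finite X] (G : Set (X → ℝ)) :
    FinitePseudoDim G := by
  classical
  have := Fintype.ofFinite X
  refine ⟨Fintype.card X, fun s hs => ?_⟩
  have key : ∀ a ∈ s, ∀ b ∈ s, a.1 = b.1 → ¬ a.2 < b.2 := by
    intro a ha b hb hab hlt
    -- Subgraphs are downward closed, so the higher of two points over one `x` cannot be picked out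
    -- alone.
    obtain ⟨h, ⟨g, -, rfl⟩, hh⟩ := hs {b} (by simpa using hb)
    have h1 := (hh b hb).2 (by simp)
    have h2 : a ∈ ({b} : Finset (X × ℝ)) := by
      refine (hh a ha).1 ?_
      simp only [decide_eq_true_eq] at h1 ⊢
      rw [hab]
      linarith
    rw [Finset.mem_singleton] at h2
    exact hlt.ne (congrArg Prod.snd h2)
  have hinj : Set.InjOn Prod.fst (s : Set (X × ℝ)) := by
    intro a ha b hb hab
    refine Prod.ext hab (le_antisymm ?_ ?_)
    · exact not_lt.1 (key b hb a ha hab.symm)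
    · exact not_lt.1 (key a ha b hb hab)
  rw [← Finset.card_image_of_injOn hinj]
  exact Finset.card_le_univ _

end FiniteClasses

/-! ### Finite-space formulas, Chernoff and Le Cam bounds -/

namespace DGP

section Discrete

variable {X : Type*} [MeasurableSpace X]

theorem labelProb_nonneg (D : DGP X) (x : X) (b : Bool) : 0 ≤ D.labelProb x b := by
  have := D.η_mem x
  cases b <;> simp [labelProb, this.1, this.2]

instance (D : DGP X) (n : ℕ) : IsProbabilityMeasure (D.sample n) := by
  unfold sample
  infer_instance

theorem sample_real_singleton (D : DGP X) {n : ℕ} (S : Fin n → X × Bool) :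
    (D.sample n).real {S} = ∏ i, D.joint.real {S i} := by
  rw [sample, Measure.real, Measure.pi_singleton, ENNReal.toReal_prod]
  rfl

variable [DiscreteMeasurableSpace X] [Fintype X]

theorem joint_real_singleton (D : DGP X) (x : X) (b : Bool) :
    D.joint.real {(x, b)} = D.μ.real {x} * D.labelProb x b := by
  have := D.prob
  have hp : ∀ b' : Bool, (fun x' : X => (x', b')) ⁻¹' {(x, b)} = if b' = b then {x} else ∅ := by
    intro b'
    ext y
    by_cases h : b' = b <;> simp [h]
  rw [Measure.real, joint, Measure.add_apply, Measure.map_apply (.of_discrete) (.singleton _),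
    Measure.map_apply (.of_discrete) (.singleton _), hp, hp]
  cases b <;>
  simp [withDensity_apply, Measure.real, D.labelProb_nonneg, mul_comm]

theorem joint_real_preimage_fst (D : DGP X) (s : Set X) :
    D.joint.real {z | z.1 ∈ s} = D.μ.real s := by
  classical
  have := D.prob
  have h1 := integral_indicator_one (μ := D.joint) (s := {z : X × Bool | z.1 ∈ s}) .of_discrete
  have h2 := integral_indicator_one (μ := D.μ) (s := s) .of_discrete
  rw [← h1, ← h2, integral_fintype .of_finite, integral_fintype .of_finite,
    Fintype.sum_prod_type]
  refine Finset.sum_congr rfl fun x _ => ?_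
  by_cases hx : x ∈ s <;> simp [hx, joint_real_singleton, labelProb, ← mul_add]

/-- The excess risk on the region `ω* ≥ c` is the integral of the margin over the part of that
region where the classifier differs from the Bayes classifier. -/
theorem excessOn_eq_sum (D : DGP X) (c : ℝ) (f : X → Bool) :
    D.excessOn c f =
      ∑ x, D.μ.real {x} * (if c ≤ D.margin x ∧ f x ≠ D.bayes x then D.margin x else 0) := by
  classical
  rw [excessOn, ← integral_indicator .of_discrete, integral_fintype .of_finite,
    Fintype.sum_prod_type]
  refine Finset.sum_congr rfl fun x _ => ?_
  by_cases hx : c ≤ D.margin x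
  · simp only [Fintype.sum_bool, joint_real_singleton, smul_eq_mul, Set.indicator,
      Set.mem_ofPred_eq, hx, if_true, true_and]
    simp only [excessLoss, margin]
    cases f x <;> cases D.bayes x <;> simp [labelProb] <;> ring
  · simp [Set.indicator, hx]

theorem condExcess_eq (D : DGP X) (c : ℝ) (f : X → Bool) :
    D.condExcess c f = D.excessOn c f / D.μ.real {x | c ≤ D.margin x} := by
  rw [condExcess, excessOn, ProbabilityTheory.cond, integral_smul_measure,
    ← D.joint_real_preimage_fst {x | c ≤ D.margin x}, div_eq_inv_mul, Measure.real,
    ENNReal.toReal_inv, smul_eq_mul]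
  rfl

theorem integral_sample (D : DGP X) {n : ℕ} (φ : (Fin n → X × Bool) → ℝ) :
    ∫ S, φ S ∂(D.sample n) = ∑ S, (∏ i, D.joint.real {S i}) * φ S := by
  rw [integral_fintype .of_finite]
  simp [sample_real_singleton]

/-- Chernoff's bound: an event on which `∏ g (S i) ≥ 1` has probability at most `(E g)ⁿ`. -/
theorem sample_real_le_pow (D : DGP X) {n : ℕ} (g : X × Bool → ℝ) (hg : ∀ z, 0 ≤ g z)
    (E : Set (Fin n → X × Bool)) (hE : ∀ S ∈ E, 1 ≤ ∏ i, g (S i)) :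
    (D.sample n).real E ≤ (∑ z, D.joint.real {z} * g z) ^ n := by
  classical
  rw [← integral_indicator_one .of_discrete, integral_sample, Fintype.sum_pow]
  refine Finset.sum_le_sum fun S _ => ?_
  rw [Finset.prod_mul_distrib]
  refine mul_le_mul_of_nonneg_left ?_ (Finset.prod_nonneg fun _ _ => measureReal_nonneg)
  by_cases hS : S ∈ E
  · simpa [hS] using hE S hS
  · simpa [hS] using Finset.prod_nonneg fun i _ => hg (S i)

/-- Le Cam's two-point bound in terms of the affinity `∑ √(P Q)` of a single draw. -/
theorem affinity_pow_le (D₁ D₂ : DGP X) {n : ℕ} (W : Set (Fin n → X × Bool)) :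
    (∑ z, √(D₁.joint.real {z} * D₂.joint.real {z})) ^ n - 1 / 2 ≤
      (D₁.sample n).real W + (D₂.sample n).real Wᶜ := by
  classical
  have hsum : ∀ D : DGP X, ∑ S : Fin n → X × Bool, ∏ i, D.joint.real {S i} = 1 := by
    intro D
    simpa using (D.integral_sample (n := n) fun _ => 1).symm
  have hmain : ∀ S : Fin n → X × Bool,
      ∏ i, √(D₁.joint.real {S i} * D₂.joint.real {S i}) ≤
        (∏ i, D₁.joint.real {S i}) * W.indicator 1 S +
        (∏ i, D₂.joint.real {S i}) * Wᶜ.indicator 1 S +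
        1 / 4 * ((∏ i, D₁.joint.real {S i}) + ∏ i, D₂.joint.real {S i}) := by
    intro S
    have hu : 0 ≤ ∏ i, D₁.joint.real {S i} := Finset.prod_nonneg fun _ _ => measureReal_nonneg
    have hv : 0 ≤ ∏ i, D₂.joint.real {S i} := Finset.prod_nonneg fun _ _ => measureReal_nonneg
    have hprod : ∏ i, √(D₁.joint.real {S i} * D₂.joint.real {S i}) =
        √(∏ i, D₁.joint.real {S i}) * √(∏ i, D₂.joint.real {S i}) := by
      rw [← Real.sqrt_mul hu, ← Finset.prod_mul_distrib, Real.sqrt_prod]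
      exact fun _ _ => mul_nonneg measureReal_nonneg measureReal_nonneg
    rw [hprod]
    generalize (∏ i, D₁.joint.real {S i}) = u at *
    generalize (∏ i, D₂.joint.real {S i}) = v at *
    have hu2 := Real.mul_self_sqrt hu
    have hv2 := Real.mul_self_sqrt hv
    by_cases hS : S ∈ W <;> simp [hS]
    -- AM-GM in the form `√u √v ≤ u + v / 4`; the quarters sum to the loss `1 / 2`.
    · nlinarith [sq_nonneg (√u - √v / 2)]
    · nlinarith [sq_nonneg (√v - √u / 2)]
  have := Finset.sum_le_sum fun S (_ : S ∈ Finset.univ) => hmain S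
  rw [← Fintype.sum_pow (fun z => √(D₁.joint.real {z} * D₂.joint.real {z})),
    Finset.sum_add_distrib, Finset.sum_add_distrib, ← Finset.mul_sum,
    Finset.sum_add_distrib, hsum, hsum, ← integral_sample, ← integral_sample,
    integral_indicator_one .of_discrete, integral_indicator_one .of_discrete] at this
  linarith

end Discrete

end DGP

/-! ### The three-point family -/

namespace DGP

/-- The conditional probabilities of the three-point process with margin `m` at the points `0`
and `1` and pure noise at the point `2`; the Bayes label is `b` at `0` and `true` at `1`. -/
noncomputable def threePointEta (m : ℝ) (b : Bool) : Fin 3 → ℝ :=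
  ![if b then (1 + m) / 2 else (1 - m) / 2, (1 + m) / 2, 1 / 2]

/-- `D` is the three-point process with masses `q`, `p - q`, `1 - p`, margin `m` and Bayes label
`b` at the point `0`. -/
structure IsThreePoint (D : DGP (Fin 3)) (p q m : ℝ) (b : Bool) : Prop where
  mass : ∀ x, D.μ.real {x} = ![q, p - q, 1 - p] x
  eta : D.η = threePointEta m b

theorem exists_isThreePoint {p q m : ℝ} (hp : p ≤ 1) (hq : 0 ≤ q) (hqp : q ≤ p) (hm : 0 ≤ m)
    (hm1 : m ≤ 1) (b : Bool) : ∃ D : DGP (Fin 3), D.IsThreePoint p q m b := by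
  have h1 : 0 ≤ p - q := sub_nonneg.2 hqp
  have h2 : 0 ≤ 1 - p := sub_nonneg.2 hp
  let μ : Measure (Fin 3) := ENNReal.ofReal q • Measure.dirac 0 +
    ENNReal.ofReal (p - q) • Measure.dirac 1 + ENNReal.ofReal (1 - p) • Measure.dirac 2
  have hμ : IsProbabilityMeasure μ := by
    constructor
    simp only [μ, Measure.add_apply, Measure.smul_apply, measure_univ, smul_eq_mul, mul_one]
    rw [← ENNReal.ofReal_add hq h1, ← ENNReal.ofReal_add (by linarith) h2]
    simp
  refine ⟨⟨μ, hμ, threePointEta m b, .of_discrete, ?_⟩, ?_, rfl⟩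
  · intro x
    fin_cases x <;> cases b <;> constructor <;> simp [threePointEta] <;> linarith
  · intro x
    fin_cases x <;> simp [μ, Measure.real, hq, h1, h2]

namespace IsThreePoint

variable {D : DGP (Fin 3)} {p q m : ℝ} {b : Bool}

theorem bayes_eq (h : D.IsThreePoint p q m b) (hm : 0 < m) : D.bayes = ![b, true, true] := by
  funext x
  fin_cases x <;> cases b <;> simp [bayes, h.eta, threePointEta] <;> linarith

theorem margin_eq (h : D.IsThreePoint p q m b) (hm : 0 < m) : D.margin = ![m, m, 0] := by
  funext x
  fin_cases x <;> cases b <;>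
    simp [margin, h.bayes_eq hm, labelProb, h.eta, threePointEta] <;> ring

/-- A general `s` serves both regions `c ≤ ω*` and `c < ω*`, which coincide here. -/
theorem real_margin_region (h : D.IsThreePoint p q m b) (hm : 0 < m) {s : Set ℝ} (hms : m ∈ s)
    (h0 : 0 ∉ s) : D.μ.real {x | D.margin x ∈ s} = p := by
  classical
  have := D.prob
  rw [← integral_indicator_one .of_discrete, integral_fintype .of_finite]
  simp [h.mass, h.margin_eq hm, Fin.sum_univ_three, Set.indicator, hms, h0]

theorem excessOn_eq (h : D.IsThreePoint p q m b) (hm : 0 < m) {c : ℝ} (hc : 0 < c) (hcm : c < m)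
    (f : Fin 3 → Bool) :
    D.excessOn c f =
      q * (if f 0 ≠ b then m else 0) + (p - q) * (if f 1 ≠ true then m else 0) := by
  rw [excessOn_eq_sum]
  simp [h.mass, h.margin_eq hm, h.bayes_eq hm, Fin.sum_univ_three, hcm.le, hc.not_ge]

theorem condExcess_eq (h : D.IsThreePoint p q m b) (hm : 0 < m) {c : ℝ} (hc : 0 < c)
    (hcm : c < m) (f : Fin 3 → Bool) : D.condExcess c f = D.excessOn c f / p := by
  rw [DGP.condExcess_eq]
  congr 1
  exact h.real_margin_region hm (s := Set.Ici c) hcm.le (by simpa using hc)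

theorem joint_real_singleton (h : D.IsThreePoint p q m b) (x : Fin 3) (y : Bool) :
    D.joint.real {(x, y)} = ![q, p - q, 1 - p] x *
      (if y then threePointEta m b x else 1 - threePointEta m b x) := by
  rw [DGP.joint_real_singleton, h.mass, labelProb, h.eta]

/-! ### Upper bound for weighted ERM -/

/-- The labels that differ from the Bayes label are at least half of those observed at the point
`0` only with exponentially small probability. -/
theorem sample_real_minority_le (h : D.IsThreePoint p q m b) (hm : 0 < m) (n : ℕ) :
    (D.sample n).real {S | 0 ≤ ∑ i, if (S i).1 = 0 then (if (S i).2 = b then (-1 : ℝ) else 1)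
      else 0} ≤ Real.exp (-(n * (q * m ^ 2 / 2))) := by
  let Z : Fin 3 × Bool → ℝ := fun z => if z.1 = 0 then (if z.2 = b then (-1 : ℝ) else 1) else 0
  have ht : 0 < 1 + m := by linarith
  have hlog : 0 ≤ Real.log (1 + m) := Real.log_nonneg (by linarith)
  have hexp : Real.exp (-Real.log (1 + m)) = (1 + m)⁻¹ := by
    rw [Real.exp_neg, Real.exp_log ht]
  -- The tilt `log (1 + m)` is not optimal but stays finite at `m = 1`, and gives exactly `1 - q m²
  -- / 2`.
  refine (D.sample_real_le_pow (fun z => Real.exp (Real.log (1 + m) * Z z))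
    (fun z => (Real.exp_pos _).le) _ ?_).trans ?_
  · intro S hS
    rw [← Real.exp_sum, ← Finset.mul_sum]
    exact Real.one_le_exp (mul_nonneg hlog hS)
  · have hE : ∑ z, D.joint.real {z} * Real.exp (Real.log (1 + m) * Z z) = 1 - q * m ^ 2 / 2 := by
      rw [Fintype.sum_prod_type]
      cases b <;>
        simp [Fin.sum_univ_three, h.joint_real_singleton, threePointEta, Z, hexp,
          Real.exp_log ht] <;> field_simp <;> ring
    have hE0 : 0 ≤ 1 - q * m ^ 2 / 2 :=
      hE ▸ Finset.sum_nonneg fun z _ => mul_nonneg measureReal_nonneg (Real.exp_pos _).le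
    rw [hE, ← mul_neg, Real.exp_nat_mul]
    exact pow_le_pow_left₀ hE0 (by linarith [Real.add_one_le_exp (-(q * m ^ 2 / 2))]) n

/-- The upper bound for weighted empirical risk minimisation on a three-point process, over the
classifiers that are correct at the points `1` and `2`. -/
theorem sample_real_weightedERM_le (h : D.IsThreePoint p q m b) (hp : 0 < p) (hq : 0 ≤ q)
    (hqp : q ≤ p) {c : ℝ} (hc : 0 < c) (hcm : c < m) (hm1 : m ≤ 1) {ε δ : ℝ} (hε : 0 < ε)
    (hδ : 0 < δ) (hδ1 : δ < 1) {n : ℕ} (hn : 2 * Real.log (2 / δ) / ε ≤ n) {ω : Fin 3 → ℝ}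
    (hω : ∀ x, ω x ∈ Set.Icc (0 : ℝ) 1) (hωε : ∫ x, (ω x - D.margin x) ^ 2 ∂D.μ ≤ ε) :
    (D.sample n).real {S | ∃ f, IsWeightedERM {f | f 1 = true ∧ f 2 = true} ω S f ∧
      ε / (c * p) < D.condExcess c f} ≤ δ := by
  have hm : 0 < m := hc.trans hcm
  have := D.prob
  by_cases hbig : q * m ≤ ε / c
  · refine le_of_eq_of_le ?_ hδ.le
    rw [← measureReal_empty (μ := D.sample n)]
    congr 1
    refine Set.eq_empty_of_forall_notMem ?_
    rintro S ⟨f, ⟨hf, -⟩, hlt⟩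
    refine hlt.not_ge ?_
    rw [h.condExcess_eq hm hc hcm, h.excessOn_eq hm hc hcm, ← div_div, hf.1]
    gcongr
    by_cases hfb : f 0 = b
    · simpa [hfb] using (div_pos hε hc).le
    · simpa [hfb] using hbig
  · rw [not_le, div_lt_iff₀ hc] at hbig
    have hq0 : 0 < q := by
      rcases hq.eq_or_lt with rfl | hq0
      · simp only [zero_mul] at hbig
        exact absurd hbig hε.not_gt
      · exact hq0
    have hqm : ε < q * m ^ 2 := by nlinarith [mul_pos hq0 hm]
    -- If `ω 0 = 0`, the point `0` alone contributes `q m² > ε` to the squared error of `ω`.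
    have hω0 : 0 < ω 0 := by
      refine (hω 0).1.lt_of_ne' fun h0 => ?_
      rw [integral_fintype .of_finite] at hωε
      simp only [Fin.sum_univ_three, h.mass, h.margin_eq hm, h0, smul_eq_mul] at hωε
      simp at hωε
      have h1 := mul_nonneg (sub_nonneg.2 hqp) (sq_nonneg (ω 1 - m))
      have h2 : 0 ≤ (1 - p) * ω 2 ^ 2 := by
        refine mul_nonneg ?_ (sq_nonneg _)
        have := h.mass 2
        simp only [Matrix.cons_val] at this
        exact this ▸ measureReal_nonneg
      linarith
    have hlog : 0 < Real.log (2 / δ) := Real.log_pos (by rw [lt_div_iff₀ hδ]; linarith)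
    have hn0 : (0 : ℝ) < n := lt_of_lt_of_le (by positivity) hn
    have hnε : Real.log (2 / δ) ≤ n * (q * m ^ 2 / 2) := by
      rw [div_le_iff₀ hε] at hn
      nlinarith
    calc _ ≤ _ := measureReal_mono ?_ (measure_ne_top _ _)
      _ ≤ _ := h.sample_real_minority_le hm n
      _ ≤ Real.exp (-Real.log (2 / δ)) := Real.exp_le_exp.2 (neg_le_neg hnε)
      _ = δ / 2 := by rw [Real.exp_neg, Real.exp_log (by positivity), inv_div]
      _ ≤ δ := by linarith
    rintro S ⟨f, ⟨hf, hmin⟩, hlt⟩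
    have hfb : f 0 ≠ b := by
      intro hfb
      rw [h.condExcess_eq hm hc hcm, h.excessOn_eq hm hc hcm, hf.1, hfb] at hlt
      simp only [ne_eq, not_true_eq_false, if_false, mul_zero, add_zero, zero_div] at hlt
      exact hlt.not_ge (by positivity)
    -- Compare with the Bayes classifier: the two differ only at `0`, so the risk gap is a positive
    -- multiple of the wrong-minus-right label count there.
    have hle := hmin ![b, true, true] ⟨rfl, rfl⟩
    rw [weightedRisk, weightedRisk, mul_le_mul_iff_right₀ (by positivity), ← sub_nonneg,
      ← Finset.sum_sub_distrib] at hle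
    refine nonneg_of_mul_nonneg_right (hle.trans_eq ?_) hω0
    rw [Finset.mul_sum]
    refine Finset.sum_congr rfl fun i _ => ?_
    obtain ⟨x, y⟩ := S i
    have hf0 : f 0 = !b := Bool.eq_not_of_ne hfb
    fin_cases x
    · cases b <;> cases y <;> simp [hf0]
    · simp [hf.1]
    · simp [hf.2]

end IsThreePoint

/-! ### Two-point lower bound -/

theorem IsThreePoint.le_affinity {D₁ D₂ : DGP (Fin 3)} {p q m : ℝ}
    (h₁ : D₁.IsThreePoint p q m true) (h₂ : D₂.IsThreePoint p q m false) (hm : 0 ≤ m) (hm1 : m ≤ 1) :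
    1 - q * m ^ 2 ≤ ∑ z, √(D₁.joint.real {z} * D₂.joint.real {z}) := by
  have ha : 0 ≤ 1 + m := by linarith
  have hb : 0 ≤ 1 - m := by linarith
  have hflip : ∀ y : Bool, q * ((1 - m ^ 2) / 2) ≤
      √(D₁.joint.real {(0, y)} * D₂.joint.real {(0, y)}) := by
    intro y
    -- The root equals `(q / 2) √(1 - m²)`, and `√t ≥ t` on `[0, 1]`.
    refine Real.le_sqrt_of_sq_le ?_
    have hprod : D₁.joint.real {(0, y)} * D₂.joint.real {(0, y)} =
        q ^ 2 * ((1 - m ^ 2) / 4) := by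
      cases y <;> simp [h₁.joint_real_singleton, h₂.joint_real_singleton, threePointEta] <;> ring
    rw [hprod, mul_pow]
    refine mul_le_mul_of_nonneg_left ?_ (sq_nonneg q)
    nlinarith [mul_nonneg ha hb, sq_nonneg m]
  have hsame : ∀ x : Fin 3, x ≠ 0 → ∀ y : Bool,
      √(D₁.joint.real {(x, y)} * D₂.joint.real {(x, y)}) = D₁.joint.real {(x, y)} := by
    intro x hx y
    have : D₂.joint.real {(x, y)} = D₁.joint.real {(x, y)} := by
      rw [h₁.joint_real_singleton, h₂.joint_real_singleton]
      fin_cases x <;> simp_all [threePointEta]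
    rw [this, Real.sqrt_mul_self measureReal_nonneg]
  rw [Fintype.sum_prod_type, Fin.sum_univ_three]
  simp only [Fintype.sum_bool]
  rw [hsame 1 (by decide), hsame 1 (by decide), hsame 2 (by decide), hsame 2 (by decide)]
  have htrue := hflip true
  have hfalse := hflip false
  have hone : D₁.joint.real {(1, true)} + D₁.joint.real {(1, false)} = p - q := by
    simp [h₁.joint_real_singleton, threePointEta]
    ring
  have htwo : D₁.joint.real {(2, true)} + D₁.joint.real {(2, false)} = 1 - p := by
    simp [h₁.joint_real_singleton, threePointEta]
    ring
  linarith

/-- On a three-point process the expected excess risk is at least `q m` times the probability of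
a wrong decision at the point `0`. -/
theorem IsThreePoint.le_integral_excessOn {D : DGP (Fin 3)} {p q m : ℝ} {b : Bool}
    (h : D.IsThreePoint p q m b) (hqp : q ≤ p) {c : ℝ} (hc : 0 < c) (hcm : c < m) {n : ℕ}
    (A : (Fin n → Fin 3 × Bool) → (Fin 3 → Bool)) :
    q * m * (D.sample n).real {S | A S 0 ≠ b} ≤ ∫ S, D.excessOn c (A S) ∂(D.sample n) := by
  have hm : 0 < m := hc.trans hcm
  rw [← integral_indicator_one .of_discrete, ← integral_const_mul]
  refine integral_mono .of_finite .of_finite fun S => ?_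
  simp only [h.excessOn_eq hm hc hcm]
  have : 0 ≤ (p - q) * (if A S 1 ≠ true then m else 0) :=
    mul_nonneg (sub_nonneg.2 hqp) (by split_ifs <;> linarith)
  by_cases hS : A S 0 = b <;> simp [hS] <;> simpa using this

/-- No learning rule can tell apart the two three-point processes that differ in the Bayes label
at the point `0` when `n q m² ≤ 1 / 4`. -/
theorem exists_isThreePoint_le_integral_excessOn {p q m : ℝ} (hp : p ≤ 1) (hq : 0 ≤ q)
    (hqp : q ≤ p) (hm1 : m ≤ 1) {c : ℝ} (hc : 0 < c) (hcm : c < m) {n : ℕ}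
    (hn : n * (q * m ^ 2) ≤ 1 / 4) (A : (Fin n → Fin 3 × Bool) → (Fin 3 → Bool)) :
    ∃ (D : DGP (Fin 3)) (b : Bool), D.IsThreePoint p q m b ∧
      q * m / 8 ≤ ∫ S, D.excessOn c (A S) ∂(D.sample n) := by
  have hm : 0 < m := hc.trans hcm
  obtain ⟨D₁, h₁⟩ := exists_isThreePoint hp hq hqp hm.le hm1 true
  obtain ⟨D₂, h₂⟩ := exists_isThreePoint hp hq hqp hm.le hm1 false
  have hqm : q * m ^ 2 ≤ 1 := by
    have := pow_le_one₀ (n := 2) hm.le hm1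
    nlinarith [sq_nonneg m]
  have haff : 3 / 4 ≤ (∑ z, √(D₁.joint.real {z} * D₂.joint.real {z})) ^ n := calc
    3 / 4 ≤ 1 + n * -(q * m ^ 2) := by linarith
    _ ≤ (1 + -(q * m ^ 2)) ^ n := one_add_mul_le_pow (by linarith) n
    _ ≤ _ := pow_le_pow_left₀ (by linarith)
      (by linarith [h₁.le_affinity h₂ hm.le hm1]) n
  have hcam := affinity_pow_le D₁ D₂ {S | A S 0 ≠ true}
  have hcompl : {S | A S 0 ≠ true}ᶜ = {S | A S 0 ≠ false} := by
    ext S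
    simp
  rw [hcompl] at hcam
  have hqm0 : 0 ≤ q * m := by positivity
  -- The two error probabilities sum to at least `3/4 - 1/2 = 1/4`.
  by_cases hw : 1 / 8 ≤ (D₁.sample n).real {S | A S 0 ≠ true}
  · refine ⟨D₁, true, h₁, le_trans ?_ (h₁.le_integral_excessOn hqp hc hcm A)⟩
    nlinarith
  · refine ⟨D₂, false, h₂, le_trans ?_ (h₂.le_integral_excessOn hqp hc hcm A)⟩
    nlinarith

end DGP

theorem mainTheorem5 :
    ∃ κ K : ℝ, 0 < κ ∧ 0 < K ∧
    ∃ (X : Type) (_ : MeasurableSpace X) (_ : DiscreteMeasurableSpace X) (_ : Finite X)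
      (F : Set (X → Bool)) (G : Set (X → ℝ)),
      FiniteVCDim F ∧ FinitePseudoDim G ∧ (∀ g ∈ G, ∀ x, g x ∈ Set.Icc (0 : ℝ) 1) ∧
      ∀ c p : ℝ, c ∈ Set.Ioo (0 : ℝ) 1 → p ∈ Set.Ioc (0 : ℝ) 1 →
      ∃ Θ : Set (DGP X),
        -- the DGPs are well specified, with a large-margin region of mass `p` and pure noise elsewhere
        (∀ D ∈ Θ, D.bayes ∈ F ∧ D.η ∈ G ∧ (∀ x, D.margin x = 0 ∨ c < D.margin x) ∧
          D.μ.real {x | c < D.margin x} = p) ∧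
        -- lower bound for every learning rule, proper or not
        (∀ ε : ℝ, 0 < ε → ε ≤ κ * p * c ^ 2 → ∀ n : ℕ, (n : ℝ) ≤ κ / ε →
          ∀ A : (Fin n → X × Bool) → (X → Bool), ∃ D ∈ Θ,
            ε ≤ c * ∫ S, D.excessOn c (A S) ∂(D.sample n) ∧
            ε / (c * D.μ.real {x | c < D.margin x}) ≤ ∫ S, D.condExcess c (A S) ∂(D.sample n)) ∧
        -- the matching upper bound, attained by weighted ERM with any accurate weight function
        -- (in particular with the margin function itself)
        (∀ D ∈ Θ, ∀ ε δ : ℝ, 0 < ε → 0 < δ → δ < 1 → ∀ n : ℕ,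
          K * Real.log (2 / δ) / ε ≤ (n : ℝ) →
          ∀ ω : X → ℝ, (∀ x, ω x ∈ Set.Icc (0 : ℝ) 1) → ∫ x, (ω x - D.margin x) ^ 2 ∂D.μ ≤ ε →
            (D.sample n).real {S | ∃ f, IsWeightedERM F ω S f ∧
              ε / (c * D.μ.real {x | c < D.margin x}) < D.condExcess c f} ≤ δ) := by
  refine ⟨1 / 128, 2, by norm_num, by norm_num, Fin 3, inferInstance, inferInstance,
    inferInstance, {f | f 1 = true ∧ f 2 = true}, {g | ∀ x, g x ∈ Set.Icc (0 : ℝ) 1},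
    finiteVCDim_of_finite _, finitePseudoDim_of_finite _, fun g hg => hg, ?_⟩
  rintro c p ⟨hc, hc1⟩ ⟨hp, hp1⟩
  -- The margin must exceed `c` strictly but stay comparable to it, so that `m² / c² ≤ 4`.
  obtain ⟨m, hcm, hm1, hm2⟩ : ∃ m, c < m ∧ m ≤ 1 ∧ m ≤ 2 * c :=
    ⟨min 1 (2 * c), lt_min hc1 (by linarith), min_le_left _ _, min_le_right _ _⟩
  have hm : 0 < m := hc.trans hcm
  have hregion : ∀ {D : DGP (Fin 3)} {q : ℝ} {b : Bool}, D.IsThreePoint p q m b →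
      D.μ.real {x | c < D.margin x} = p := fun h =>
    h.real_margin_region hm (s := Set.Ioi c) hcm (by simpa using hc.le)
  -- `q` ranges freely because `Θ` is fixed before `ε`.
  refine ⟨{D | ∃ q b, 0 ≤ q ∧ q ≤ p ∧ D.IsThreePoint p q m b}, ?_, ?_, ?_⟩
  · rintro D ⟨q, b, -, -, h⟩
    refine ⟨by simp [h.bayes_eq hm], D.η_mem, fun x => ?_, hregion h⟩
    rw [h.margin_eq hm]
    fin_cases x <;> simp [hcm]
  · intro ε hε hεp n hn A
    -- With `q = 8 ε / c²` the bound `q m / 8` exceeds `ε / c`; `κ = 1 / 128` makes `n q m² ≤ 8 κ ·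
    -- 4 = 1 / 4`.
    have hq : 0 ≤ 8 * ε / c ^ 2 := by positivity
    have hqp : 8 * ε / c ^ 2 ≤ p := by
      rw [div_le_iff₀ (by positivity)]
      nlinarith [mul_pos hp (pow_pos hc 2)]
    have hnq : n * (8 * ε / c ^ 2 * m ^ 2) ≤ 1 / 4 := by
      rw [le_div_iff₀ hε] at hn
      have hmc : m ^ 2 / c ^ 2 ≤ 4 := by
        rw [div_le_iff₀ (by positivity)]
        nlinarith
      calc n * (8 * ε / c ^ 2 * m ^ 2) = 8 * (n * ε) * (m ^ 2 / c ^ 2) := by ring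
        _ ≤ 8 * (1 / 128) * 4 := by gcongr
        _ = 1 / 4 := by norm_num
    obtain ⟨D, b, h, hD⟩ :=
      DGP.exists_isThreePoint_le_integral_excessOn hp1 hq hqp hm1 hc hcm hnq A
    have hlow : ε / c ≤ ∫ S, D.excessOn c (A S) ∂(D.sample n) := by
      refine le_trans ?_ hD
      calc ε / c = ε / c ^ 2 * c := by field_simp
        _ ≤ ε / c ^ 2 * m := by gcongr
        _ = _ := by ring
    refine ⟨D, ⟨_, b, hq, hqp, h⟩, ?_, ?_⟩
    · rwa [div_le_iff₀' hc] at hlow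
    · simp only [h.condExcess_eq hm hc hcm]
      rw [integral_div, hregion h, ← div_div]
      gcongr
  · rintro D ⟨q, b, hq, hqp, h⟩ ε δ hε hδ hδ1 n hn ω hω hωε
    rw [hregion h]
    exact h.sample_real_weightedERM_le hp hq hqp hc hcm hm1 hε hδ hδ1 hn hω hωε
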